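/- Let $\sigma$ be a finite relational vocabulary; all $\sigma$-structures are finite with non-empty universe. A homomorphism is a map of universes sending every tuple of each relation $R$ of the source to a tuple of the relation $R$ of the target. A substructure of $\mathbb A$ is a structure $\mathbb B$ with $B\subseteq A$ and $R(\mathbb B)\subseteq R(\mathbb A)$ for all $R\in\sigma$; it is a retract if there is a homomorphism $\mathbb A\to\mathbb B$ that is the identity on $B$; $\mathbb A$ is a core if it has no retract other than itself. $\mathbb A$ has finite duality if there is a finite set $\mathcal F$ of structures, none of which admits a homomorphism to $\mathbb A$, such that every structure $\mathbb B$ that admits no homomorphism to $\mathbb A$ receives a homomorphism from some $\mathbb C\in\mathcal F$. The $n$-th power $\mathbb A^n$ has universe $A^n$ and coordinatewise relations. The one-tolerant $n$-th power ${}^1\mathbb A^n$ has universe $A^n$, and a tuple $((a_{1,1},\dots,a_{1,n}),\dots,(a_{r,1},\dots,a_{r,n}))$ belongs to $R({}^1\mathbb A^n)$, for $R\in\sigma$ of arity $r$, if and only if $|\{k : (a_{1,k},\dots,a_{r,k})\in R(\mathbb A)\}|\ge n-1$. Let $\mathbb A$ be a core with finite duality and let $n\ge 1$. Then every homomorphism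 $\varphi:{}^1\mathbb A^n\to\mathbb A$ is a near-unanimity operation, i.e. $\varphi$ is a homomorphism from $\mathbb A^n$ to $\mathbb A$ and $$\varphi(y,x,\dots,x)=\varphi(x,y,x,\dots,x)=\dots=\varphi(x,\dots,x,y)=x\qquad\text{for all }x,y\in A.$$ (The name near-unanimity operation is customary for $n\ge 3$; the identities hold for $n=1,2$ as well.) -/

import Mathlib

open FirstOrder FirstOrder.Language.Structure

universe u v w

namespace RelStr

/-- A substructure in the sense of relational structures: a non-empty subset of the universe
together with some of the hyperedges on it (it need not be induced). -/
@[ext]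
structure Substr (L : FirstOrder.Language.{u, v}) (A : Type w) [L.Structure A] where
  carrier : Set A
  nonempty : carrier.Nonempty
  rel : ∀ r : ℕ, L.Relations r → Set (Fin r → A)
  mem_carrier : ∀ (r : ℕ) (R : L.Relations r), ∀ x ∈ rel r R, ∀ i, x i ∈ carrier
  relMap : ∀ (r : ℕ) (R : L.Relations r), ∀ x ∈ rel r R, RelMap R x

/-- A substructure is itself a structure on its carrier. -/
instance Substr.instStructure {L : FirstOrder.Language.{u, v}} [L.IsRelational] {A : Type w} [L.Structure A]
    (S : Substr L A) : L.Structure S.carrier where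
  funMap f := isEmptyElim f
  RelMap {r} R x := (fun i => (x i : A)) ∈ S.rel r R

/-- The structure `A`, regarded as a substructure of itself. -/
def Substr.whole (L : FirstOrder.Language.{u, v}) (A : Type w) [L.Structure A] [Nonempty A] :
    Substr L A where
  carrier := Set.univ
  nonempty := Set.univ_nonempty
  rel _ R := {x | RelMap R x}
  mem_carrier _ _ _ _ _ := Set.mem_univ _
  relMap _ _ _ hx := hx

/-- `S` is a retract of `A`: some homomorphism from `A` to `S` is the identity on `S`. -/
def Substr.IsRetract {L : FirstOrder.Language.{u, v}} [L.IsRelational] {A : Type w} [L.Structure A]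
    (S : Substr L A) : Prop :=
  ∃ ρ : A →[L] S.carrier, ∀ b : S.carrier, ρ (b : A) = b

/-- `A` is a core: it has no retract other than itself. -/
def IsCore (L : FirstOrder.Language.{u, v}) [L.IsRelational] (A : Type w) [L.Structure A] [Nonempty A] :
    Prop :=
  ∀ S : Substr L A, S.IsRetract → S = Substr.whole L A

/-- A finite non-empty `L`-structure, bundled. -/
structure FinStr (L : FirstOrder.Language.{u, v}) where
  carrier : Type w
  [str : L.Structure carrier]
  [finite : Finite carrier]
  [nonempty : Nonempty carrier]

attribute [instance] FinStr.str FinStr.finite FinStr.nonempty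

/-- `F` is a complete set of obstructions for `A`: no member of `F` maps to `A`, and every
structure that does not map to `A` receives a homomorphism from a member of `F`. -/
def IsCompleteObstructionSet (L : FirstOrder.Language.{u, v}) (A : Type w) [L.Structure A]
    (F : Set (FinStr.{u, v, w} L)) : Prop :=
  (∀ C ∈ F, IsEmpty (C.carrier →[L] A)) ∧
    ∀ B : FinStr.{u, v, w} L, IsEmpty (B.carrier →[L] A) →
      ∃ C ∈ F, Nonempty (C.carrier →[L] B.carrier)

/-- `A` has finite duality: it admits a finite complete set of obstructions. -/
def HasFiniteDuality (L : FirstOrder.Language.{u, v}) (A : Type w) [L.Structure A] : Prop :=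
  ∃ F : Set (FinStr.{u, v, w} L), F.Finite ∧ IsCompleteObstructionSet L A F

/-- The universe `A ^ n` of the `n`-th power of `A`. -/
def Power (A : Type w) (n : ℕ) : Type w := Fin n → A

/-- The `n`-th power: relations hold in every coordinate. -/
instance Power.instStructure {L : FirstOrder.Language.{u, v}} [L.IsRelational] {A : Type w} [L.Structure A]
    {n : ℕ} : L.Structure (Power A n) where
  funMap f := isEmptyElim f
  RelMap {r} R x := ∀ k : Fin n, RelMap R (fun j : Fin r => x j k)

/-- The universe `A ^ n` of the one-tolerant `n`-th power of `A`. -/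
def OneTolerantPower (A : Type w) (n : ℕ) : Type w := Fin n → A

/-- The one-tolerant `n`-th power: relations hold in at least `n - 1` of the coordinates. -/
instance OneTolerantPower.instStructure {L : FirstOrder.Language.{u, v}} [L.IsRelational] {A : Type w}
    [L.Structure A] {n : ℕ} : L.Structure (OneTolerantPower A n) where
  funMap f := isEmptyElim f
  RelMap {r} R x := n ≤ {k : Fin n | RelMap R (fun j : Fin r => x j k)}.ncard + 1

/-- `φ` is an operation on the structure `A`, i.e. a homomorphism from the `n`-th power to `A`. -/
def IsOperation (L : FirstOrder.Language.{u, v}) [L.IsRelational] {A : Type w} [L.Structure A] {n : ℕ}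
    (φ : (Fin n → A) → A) : Prop :=
  ∃ f : Power A n →[L] A, ∀ a : Fin n → A, f a = φ a

/-- `φ` is an operation on `A` satisfying
`φ (y, x, …, x) = φ (x, y, x, …, x) = ⋯ = φ (x, …, x, y) = x`. The term near unanimity operation
is customary for `3 ≤ n`; for smaller `n` the same identities are required. -/
def IsNearUnanimity (L : FirstOrder.Language.{u, v}) [L.IsRelational] {A : Type w} [L.Structure A] {n : ℕ}
    (φ : (Fin n → A) → A) : Prop :=
  IsOperation L φ ∧ ∀ (k : Fin n) (x y : A), φ (Function.update (fun _ => x) k y) = x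

end RelStr

namespace RelStr

open Function

/-! Fixing y in coordinate k turns x ↦ φ(x, …, y, …, x) into an endomorphism of A, since only
coordinate k can violate a relation. So it suffices that A is rigid. Finite duality yields a
homomorphism ψ from some one-tolerant power: with more coordinates than any obstruction has
hyperedges, no obstruction maps to that power (`HasFiniteDuality.exists_oneTolerantPower_hom`). For
an endomorphism f, change (a, …, a) into (f a, …, f a) one coordinate at a time. By tolerance, each
element may choose the changing entry freely, and in a core such freedom has no effect
(`IsCore.eq_of_mix`). Hence ψ(a, …, a) = ψ(f a, …, f a), and ψ is injective on the diagonal. -/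

/-- Some positive iterate of a self-map of a finite type is idempotent. -/
theorem exists_iterate_idempotent {A : Type w} [Finite A] (f : A → A) :
    ∃ m, 0 < m ∧ ∀ x, f^[m] (f^[m] x) = f^[m] x := by
  obtain ⟨i, j, hij, h⟩ := Finite.exists_ne_map_eq_of_infinite (fun k : ℕ => f^[k])
  wlog hlt : i < j generalizing i j
  · exact this j i hij.symm h.symm (by omega)
  obtain ⟨p, rfl⟩ := Nat.exists_eq_add_of_lt hlt
  have step : ∀ t, f^[t + i + (p + 1)] = f^[t + i] := fun t => by
    have h' : f^[i] = f^[i + p + 1] := h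
    rw [iterate_add f t i, h', ← iterate_add]
    congr 1
    omega
  have steps : ∀ q t, f^[t + i + q * (p + 1)] = f^[t + i] := fun q => by
    induction q with
    | zero => simp
    | succ q ih =>
      intro t
      rw [← ih t, show t + i + (q + 1) * (p + 1) = (t + q * (p + 1)) + i + (p + 1) by ring,
        step, show t + q * (p + 1) + i = t + i + q * (p + 1) by ring]
  -- A multiple of the period `p + 1` that is past the preperiod `i`.
  refine ⟨(i + 1) * (p + 1), by positivity, fun x => ?_⟩
  have hle : i ≤ (i + 1) * (p + 1) := by nlinarith
  obtain ⟨t, ht⟩ := Nat.exists_eq_add_of_le' hle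
  have := congrFun (steps (i + 1) t) x
  rw [← iterate_add_apply]
  rwa [← ht] at this

variable {L : FirstOrder.Language.{u, v}} [L.IsRelational] {A : Type w} [L.Structure A]

/-- A map between structures of a relational language that preserves all relations, as a
homomorphism. -/
def homOfRel {M N : Type*} [L.Structure M] [L.Structure N] (f : M → N)
    (hf : ∀ {r : ℕ} (R : L.Relations r) (x : Fin r → M), RelMap R x → RelMap R (f ∘ x)) :
    M →[L] N where
  toFun := f
  map_fun' g := isEmptyElim g
  map_rel' := hf

/-- The substructure induced on a non-empty subset of the universe. -/
def Substr.induced (L : FirstOrder.Language.{u, v}) {A : Type w} [L.Structure A] (s : Set A)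
    (hs : s.Nonempty) : Substr L A where
  carrier := s
  nonempty := hs
  rel _ R := {x | RelMap R x ∧ ∀ i, x i ∈ s}
  mem_carrier _ _ _ hx := hx.2
  relMap _ _ _ hx := hx.1

/-- Every endomorphism of a finite core is injective. -/
theorem IsCore.injective [Finite A] [Nonempty A] (hcore : IsCore L A) {f : A → A}
    (hf : ∀ {r : ℕ} (R : L.Relations r) (x : Fin r → A), RelMap R x → RelMap R (f ∘ x)) :
    Injective f := by
  obtain ⟨m, hm, hidem⟩ := exists_iterate_idempotent f
  have hiter : ∀ (k r : ℕ) (R : L.Relations r) (x : Fin r → A),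
      RelMap R x → RelMap R (f^[k] ∘ x) := by
    intro k r R
    induction k with
    | zero => intro x hx; simpa using hx
    | succ k ih => intro x hx; exact ih _ (hf R x hx)
  have hS : (Substr.induced L (Set.range f^[m]) (Set.range_nonempty _)).IsRetract := by
    refine ⟨homOfRel (fun a => ⟨f^[m] a, a, rfl⟩) fun R x hx =>
      ⟨hiter m _ R x hx, fun i => ⟨x i, rfl⟩⟩, ?_⟩
    rintro ⟨_, a, rfl⟩
    exact Subtype.ext (hidem a)
  have hrange : Set.range f^[m] = Set.univ := congrArg Substr.carrier (hcore _ hS)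
  obtain ⟨k, rfl⟩ := Nat.exists_eq_succ_of_ne_zero hm.ne'
  rw [iterate_succ'] at hrange
  exact Finite.injective_iff_surjective.2 (Set.range_eq_univ.1 hrange).of_comp

/-- A tuple that satisfies a relation in all coordinates but one satisfies it in the
one-tolerant power. -/
theorem OneTolerantPower.relMap_of_forall_ne {n r : ℕ} (R : L.Relations r)
    (x : Fin r → OneTolerantPower A n) (k : Fin n)
    (h : ∀ l, l ≠ k → RelMap R (fun j => x j l)) : RelMap R x := by
  change n ≤ {l : Fin n | RelMap R (fun j => x j l)}.ncard + 1
  have hsub : ({k}ᶜ : Set (Fin n)) ⊆ {l : Fin n | RelMap R (fun j => x j l)} := fun l hl => h l hl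
  have h1 := Set.ncard_le_ncard hsub (Set.toFinite _)
  have h2 := Set.ncard_add_ncard_compl ({k} : Set (Fin n))
  rw [Set.ncard_singleton, Nat.card_eq_fintype_card, Fintype.card_fin] at h2
  omega

/-- A tuple of the one-tolerant power violates its relation in at most one coordinate. -/
theorem OneTolerantPower.eq_of_not_relMap {n r : ℕ} {R : L.Relations r}
    {x : Fin r → OneTolerantPower A n} (h : RelMap R x) {k l : Fin n}
    (hk : ¬ RelMap R (fun j => x j k)) (hl : ¬ RelMap R (fun j => x j l)) : k = l := by
  have h' : n ≤ {l : Fin n | RelMap R (fun j => x j l)}.ncard + 1 := h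
  have h2 := Set.ncard_add_ncard_compl {l : Fin n | RelMap R (fun j => x j l)}
  rw [Nat.card_eq_fintype_card, Fintype.card_fin] at h2
  have h3 : {l : Fin n | RelMap R (fun j => x j l)}ᶜ.ncard ≤ 1 := by omega
  exact (Set.ncard_le_one (Set.toFinite _)).1 h3 k hk l hl

/-- A structure with finite duality admits a homomorphism from one of its one-tolerant powers. -/
theorem HasFiniteDuality.exists_oneTolerantPower_hom [Finite (Σ r, L.Relations r)] [Finite A]
    [Nonempty A] (hdual : HasFiniteDuality L A) :
    ∃ n, Nonempty (OneTolerantPower A n →[L] A) := by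
  obtain ⟨F, hF, hnot, hobs⟩ := hdual
  let Edge (C : FinStr.{u, v, w} L) : Type _ :=
    Σ R : (Σ r, L.Relations r), {x : Fin R.1 → C.carrier // RelMap R.2 x}
  obtain ⟨N, hN⟩ := (hF.image fun C => Nat.card (Edge C)).bddAbove
  refine ⟨N + 1, ?_⟩
  by_contra hempty
  rw [not_nonempty_iff] at hempty
  have : Finite (OneTolerantPower A (N + 1)) := inferInstanceAs (Finite (Fin (N + 1) → A))
  have : Nonempty (OneTolerantPower A (N + 1)) := inferInstanceAs (Nonempty (Fin (N + 1) → A))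
  obtain ⟨C, hC, ⟨h⟩⟩ := hobs ⟨OneTolerantPower A (N + 1)⟩ hempty
  -- Otherwise coordinate `k` of `h` would be a homomorphism from `C` to `A`.
  have hbad : ∀ k : Fin (N + 1), ∃ e : Edge C, ¬ RelMap e.1.2 (fun j => h (e.2.1 j) k) := by
    intro k
    by_contra! hgood
    exact (hnot C hC).false (homOfRel (fun c => h c k) fun R x hx => hgood ⟨⟨_, R⟩, x, hx⟩)
  choose e he using hbad
  have hinj : Injective e := fun k l hkl =>
    OneTolerantPower.eq_of_not_relMap (h.map_rel _ _ (e k).2.2) (he k) (by rw [hkl]; exact he l)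
  have : Finite (Edge C) := inferInstanceAs (Finite (Sigma _))
  have hcard := Nat.card_le_card_of_injective e hinj
  rw [Nat.card_eq_fintype_card, Fintype.card_fin] at hcard
  have := hN ⟨C, hC, rfl⟩
  simp only at this
  omega

/-- If a family of endomorphisms of a core may be mixed freely, i.e. all its pointwise selections
are endomorphisms, then all its members agree. -/
theorem IsCore.eq_of_mix [Finite A] [Nonempty A] (hcore : IsCore L A) {Y : Type*} {β : Y → A → A}
    (hβ : ∀ (s : A → Y) {r : ℕ} (R : L.Relations r) (x : Fin r → A), RelMap R x →
      RelMap R (fun j => β (s (x j)) (x j))) (y z : Y) (a : A) : β y a = β z a := by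
  classical
  have hy : Injective (β y) := hcore.injective (hβ fun _ => y)
  obtain ⟨b, hb⟩ := Finite.injective_iff_surjective.1 hy (β z a)
  -- Switching to `z` only at `a` sends `a` and `b` to the same value, which forces `b = a`.
  let s : A → Y := fun x => if x = a then z else y
  have hs : Injective fun x => β (s x) x := hcore.injective (hβ s)
  by_cases hba : b = a
  · rw [← hb, hba]
  · exact absurd (hs (by simp [s, hba, hb])) hba

/-- A core that admits a homomorphism from a one-tolerant power is rigid. -/
theorem IsCore.eq_id_of_oneTolerantPower_hom [Finite A] [Nonempty A] (hcore : IsCore L A) {n : ℕ}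
    (φ : OneTolerantPower A n →[L] A) {f : A → A}
    (hf : ∀ {r : ℕ} (R : L.Relations r) (x : Fin r → A), RelMap R x → RelMap R (f ∘ x))
    (a : A) : f a = a := by
  classical
  -- The interpolating tuple: `f x` in the first `k` coordinates, `x` in the others.
  let γ : ℕ → A → OneTolerantPower A n := fun k x l => if (l : ℕ) < k then f x else x
  have hγ : ∀ (k : ℕ) (l : Fin n) {r : ℕ} (R : L.Relations r) (x : Fin r → A), RelMap R x →
      RelMap R (fun j => γ k (x j) l) := by
    intro k l r R x hx
    by_cases hl : (l : ℕ) < k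
    · simpa only [γ, hl, if_true] using! hf R x hx
    · simpa only [γ, hl, if_false] using hx
  have hstep : ∀ k < n, φ (γ (k + 1) a) = φ (γ k a) := by
    intro k hk
    -- `γ k a` and `γ (k + 1) a` differ at most in coordinate `i`, where any violation is tolerated.
    let i : Fin n := ⟨k, hk⟩
    have hmix := hcore.eq_of_mix (β := fun y x => φ (update (γ k x) i y))
      (fun s r R x hx => φ.map_rel R _ <| OneTolerantPower.relMap_of_forall_ne R _ i
        fun l hl => by
          have hu : ∀ j, update (γ k (x j)) i (s (x j)) l = γ k (x j) l :=
            fun j => update_of_ne hl _ _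
          simpa only [Function.comp_apply, hu] using hγ k l R x hx) (f a) a a
    have h1 : update (γ k a) i (f a) = γ (k + 1) a := by
      funext l
      by_cases hl : l = i
      · subst hl; simp [γ, i]
      · have : (l : ℕ) ≠ k := fun h => hl (Fin.ext h)
        have hiff : (l : ℕ) < k + 1 ↔ (l : ℕ) < k := by omega
        simp only [update_of_ne hl, γ, hiff]
    have h2 : update (γ k a) i a = γ k a := by
      rw [update_eq_self_iff]
      simp [i]
    simpa only [h1, h2] using hmix
  have hall : ∀ k ≤ n, φ (γ k a) = φ (γ 0 a) := by
    intro k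
    induction k with
    | zero => simp
    | succ k ih => intro hk; rw [hstep k hk, ih (by omega)]
  have hdiag : Injective fun x => φ (fun _ => x : OneTolerantPower A n) := by
    refine hcore.injective fun R x hx => φ.map_rel R (fun j _ => x j) ?_
    rcases n with _ | n
    · exact Nat.zero_le _
    · exact OneTolerantPower.relMap_of_forall_ne R _ 0 fun _ _ => hx
  refine hdiag ?_
  have h0 : γ 0 a = fun _ => a := by funext l; simp [γ]
  have hn : γ n a = fun _ => f a := by funext l; simp [γ]
  simpa only [h0, hn] using hall n le_rfl

end RelStr

theorem mainTheorem9 (L : FirstOrder.Language.{u, v}) [L.IsRelational]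
    [Finite (Σ r, L.Relations r)] (A : Type w) [L.Structure A] [Finite A] [Nonempty A]
    (hcore : RelStr.IsCore L A) (hdual : RelStr.HasFiniteDuality L A)
    (n : ℕ) (hn : 1 ≤ n) (φ : RelStr.OneTolerantPower A n →[L] A) :
    RelStr.IsNearUnanimity L (fun a : Fin n → A => φ a) := by
  obtain ⟨m, ⟨ψ⟩⟩ := hdual.exists_oneTolerantPower_hom
  refine ⟨⟨RelStr.homOfRel φ fun R x hx => φ.map_rel R x ?_, fun _ => rfl⟩, fun k x y => ?_⟩
  · exact RelStr.OneTolerantPower.relMap_of_forall_ne R x ⟨0, hn⟩ fun l _ => hx l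
  · refine hcore.eq_id_of_oneTolerantPower_hom ψ
      (f := fun x => φ (Function.update (fun _ => x) k y)) (fun R x hx => φ.map_rel R _ ?_) x
    exact RelStr.OneTolerantPower.relMap_of_forall_ne R _ k fun l hl => by
      simpa only [Function.update_of_ne hl] using hx
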